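/- Let $k$ be an arbitrary field (of any characteristic, not assumed algebraically closed or perfect), let $A$ be a nonzero finite-dimensional unital associative $k$-algebra, and let $n\ge 1$ be an integer. Suppose that $A$ is a cellular algebra, that is: there are a partially ordered set $\Lambda$, a finite set $M(\lambda)$ for each $\lambda\in\Lambda$, a $k$-basis $\{C^\lambda_{S,T} : \lambda\in\Lambda,\ S,T\in M(\lambda)\}$ of $A$, and a $k$-linear map $a\mapsto a^*$ on $A$ with $(a^*)^*=a$, $(ab)^*=b^*a^*$ and $(C^\lambda_{S,T})^*=C^\lambda_{T,S}$, such that for all $a\in A$ and $\lambda\in\Lambda$ there are scalars $R_a(T,X)\in k$ $(T,X\in M(\lambda))$ with $$C^\lambda_{S,T}\,a\equiv\sum_{X\in M(\lambda)}R_a(T,X)\,C^\lambda_{S,X}\qquad\text{for all } S,T\in M(\lambda),$$ modulo the span of the basis elements $C^\mu_{U,V}$ with $\mu<\lambda$. Let $S_n$ be the symmetric group on $\{1,\dots,n\}$, acting on the right (so $\sigma\pi$ means first $\sigma$, then $\pi$), and let $A\wr S_n$ be the vector space $kS_n\otimes_k A^{\otimes n}$ with the multiplication given on pure tensors $(\sigma;a_1,\dots,a_n)=\sigma\otimes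 a_1\otimes\cdots\otimes a_n$ by $$(\sigma;a_1,\dots,a_n)(\pi;b_1,\dots,b_n)=(\sigma\pi;\,a_{(1)\pi^{-1}}b_1,\dots,a_{(n)\pi^{-1}}b_n).$$ Then $A\wr S_n$ is semisimple if and only if both $kS_n$ and $A$ are semisimple. -/

import Mathlib

open scoped TensorProduct

/-- Cellular data on a `k`-algebra `A` in the sense of Graham and Lehrer (right-module convention):
`Lam` is the poset of cell indices, `M l` is the finite set attached to the cell index `l`,
`basis ⟨l, (S, T)⟩` is the cellular basis element `C^l_{S,T}`, and `invol` is the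
anti-involution `a ↦ a^*`. -/
structure CellularData (k A : Type*) [Field k] [Ring A] [Algebra k A]
    (Lam : Type*) [PartialOrder Lam] (M : Lam → Type*) [∀ l, Fintype (M l)] where
  /-- The cellular basis, indexed by the disjoint union of the sets `M l × M l`. -/
  basis : Module.Basis (Σ l : Lam, M l × M l) k A
  /-- The anti-involution `a ↦ a^*`. -/
  invol : A →ₗ[k] A
  invol_invol : ∀ a : A, invol (invol a) = a
  invol_mul : ∀ a b : A, invol (a * b) = invol b * invol a
  invol_basis : ∀ (l : Lam) (S T : M l), invol (basis ⟨l, (S, T)⟩) = basis ⟨l, (T, S)⟩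
  /-- `C_{S,T} a ≡ ∑_X R_a(T,X) C_{S,X}` modulo basis elements of strictly lower cell index,
  where the coefficients `R_a(T,X)` do not depend on `S`. -/
  basis_mul : ∀ (a : A) (l : Lam), ∃ R : M l → M l → k, ∀ S T : M l,
    basis ⟨l, (S, T)⟩ * a - ∑ X : M l, R T X • basis ⟨l, (S, X)⟩ ∈
      Submodule.span k {x : A | ∃ m : Lam, m < l ∧ ∃ U V : M m, x = basis ⟨m, (U, V)⟩}

/-- The `k`-vector space `kS_n ⊗ A^{⊗ n}` underlying the wreath product `A ≀ S_n`.
It is a type synonym, because it does not carry the usual product of a tensor product of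
algebras but the twisted product given below. -/
def WreathAlgebra (k A : Type*) [Field k] [Ring A] [Algebra k A] (n : ℕ) : Type _ :=
  MonoidAlgebra k (Equiv.Perm (Fin n)) ⊗[k] (⨂[k] _ : Fin n, A)

namespace WreathAlgebra

variable (k A : Type*) [Field k] [Ring A] [Algebra k A] (n : ℕ)

noncomputable instance : AddCommGroup (WreathAlgebra k A n) :=
  inferInstanceAs (AddCommGroup (MonoidAlgebra k (Equiv.Perm (Fin n)) ⊗[k] (⨂[k] _ : Fin n, A)))

noncomputable instance : Module k (WreathAlgebra k A n) :=
  inferInstanceAs (Module k (MonoidAlgebra k (Equiv.Perm (Fin n)) ⊗[k] (⨂[k] _ : Fin n, A)))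

/-- The bilinear map `(x, a) ↦ x ⊗ a` from `kS_n × A^{⊗ n}` to `A ≀ S_n`. -/
noncomputable def tmul :
    MonoidAlgebra k (Equiv.Perm (Fin n)) →ₗ[k] (⨂[k] _ : Fin n, A) →ₗ[k] WreathAlgebra k A n :=
  TensorProduct.mk k (MonoidAlgebra k (Equiv.Perm (Fin n))) (⨂[k] _ : Fin n, A)

/-- The pure tensor `(σ; a_1, …, a_n) = σ ⊗ a_1 ⊗ ⋯ ⊗ a_n`. -/
noncomputable def pureTensor (σ : Equiv.Perm (Fin n)) (a : Fin n → A) : WreathAlgebra k A n :=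
  tmul k A n (MonoidAlgebra.single σ 1) (PiTensorProduct.tprod k a)

variable {k A n} in
/-- Linear maps out of `A ≀ S_n` are determined by their values on the pure tensors. -/
theorem hom_ext {P : Type*} [AddCommMonoid P] [Module k P] {f g : WreathAlgebra k A n →ₗ[k] P}
    (h : ∀ σ a, f (pureTensor k A n σ a) = g (pureTensor k A n σ a)) : f = g := by
  apply TensorProduct.ext (R := k) (M := MonoidAlgebra k (Equiv.Perm (Fin n)))
    (N := ⨂[k] _ : Fin n, A)
  apply MonoidAlgebra.lhom_ext'
  intro σ
  apply LinearMap.ext_ring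
  apply PiTensorProduct.ext
  ext a
  exact h σ a

/-- For fixed permutations `σ`, `π`, the bilinear map on `A^{⊗ n}` sending a pair of pure tensors
`(a_1 ⊗ ⋯ ⊗ a_n, b_1 ⊗ ⋯ ⊗ b_n)` to `(σπ; a_{(1)π⁻¹} b_1, …, a_{(n)π⁻¹} b_n)`.
Here `σπ` means first `σ`, then `π` (permutations act on the right), which is `π * σ` for
the multiplication of `Equiv.Perm`. -/
noncomputable def mulPerm (σ π : Equiv.Perm (Fin n)) :
    (⨂[k] _ : Fin n, A) →ₗ[k] (⨂[k] _ : Fin n, A) →ₗ[k] WreathAlgebra k A n :=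
  ((PiTensorProduct.mul (R := k) (A := fun _ : Fin n => A)).comp
    (PiTensorProduct.reindex k (fun _ : Fin n => A) π).toLinearMap).compr₂
      (tmul k A n (MonoidAlgebra.single (π * σ) 1))

/-- The linear map out of `kS_n` with given values on the basis `S_n`. -/
noncomputable def ofPerm {P : Type*} [AddCommMonoid P] [Module k P]
    (f : Equiv.Perm (Fin n) → P) : MonoidAlgebra k (Equiv.Perm (Fin n)) →ₗ[k] P :=
  (Finsupp.linearCombination k f).comp (MonoidAlgebra.coeffLinearEquiv k).toLinearMap

/-- The multiplication of `A ≀ S_n`, as a bilinear map. -/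
noncomputable def mulMap :
    WreathAlgebra k A n →ₗ[k] WreathAlgebra k A n →ₗ[k] WreathAlgebra k A n :=
  TensorProduct.lift (ofPerm k n fun σ =>
    (TensorProduct.uncurry (.id k) (MonoidAlgebra k (Equiv.Perm (Fin n))) (⨂[k] _ : Fin n, A)
      (WreathAlgebra k A n)).comp
      (LinearMap.flip (ofPerm k n fun π => mulPerm k A n σ π)))

variable {k n} in
theorem ofPerm_single {P : Type*} [AddCommMonoid P] [Module k P]
    (f : Equiv.Perm (Fin n) → P) (σ : Equiv.Perm (Fin n)) :
    ofPerm k n f (MonoidAlgebra.single σ 1) = f σ := by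
  have h : MonoidAlgebra.coeffLinearEquiv k (MonoidAlgebra.single σ (1 : k)) =
      Finsupp.single σ 1 := rfl
  simp [ofPerm, h]

variable {k A n} in
theorem mulPerm_tprod (σ π : Equiv.Perm (Fin n)) (a b : Fin n → A) :
    mulPerm k A n σ π (PiTensorProduct.tprod k a) (PiTensorProduct.tprod k b) =
      pureTensor k A n (π * σ) (fun i => a (π⁻¹ i) * b i) := by
  change tmul k A n _ (PiTensorProduct.mul
    (PiTensorProduct.reindex k (fun _ : Fin n => A) π (PiTensorProduct.tprod k a))
    (PiTensorProduct.tprod k b)) = _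
  rw [PiTensorProduct.reindex_tprod]
  erw [PiTensorProduct.mul_tprod_tprod]
  rfl

noncomputable instance : Mul (WreathAlgebra k A n) := ⟨fun x y => mulMap k A n x y⟩

noncomputable instance : One (WreathAlgebra k A n) := ⟨pureTensor k A n 1 (fun _ => 1)⟩

/-- The multiplication rule
`(σ; a_1, …, a_n)(π; b_1, …, b_n) = (σπ; a_{(1)π⁻¹} b_1, …, a_{(n)π⁻¹} b_n)`. -/
theorem pureTensor_mul_pureTensor (σ π : Equiv.Perm (Fin n)) (a b : Fin n → A) :
    pureTensor k A n σ a * pureTensor k A n π b =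
      pureTensor k A n (π * σ) (fun i => a (π⁻¹ i) * b i) := by
  change mulMap k A n (tmul k A n _ _) (tmul k A n _ _) = _
  unfold mulMap tmul
  erw [TensorProduct.lift.tmul, ofPerm_single]
  change (ofPerm k n fun π => mulPerm k A n σ π) (MonoidAlgebra.single π 1)
    (PiTensorProduct.tprod k a) (PiTensorProduct.tprod k b) = _
  rw [ofPerm_single, mulPerm_tprod]

variable {k A n} in
/-- Associativity, proved on pure tensors and extended by trilinearity. -/
theorem mul_assoc_aux (x y z : WreathAlgebra k A n) : x * y * z = x * (y * z) := by
  have h : (mulMap k A n).compr₂ (mulMap k A n) =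
      ((LinearMap.lcomp k _ (mulMap k A n)).comp
        ((LinearMap.llcomp k (WreathAlgebra k A n) (WreathAlgebra k A n)
          (WreathAlgebra k A n)).comp (mulMap k A n))) := by
    apply hom_ext
    intro σ a
    apply hom_ext
    intro π b
    apply hom_ext
    intro τ c
    change pureTensor k A n σ a * pureTensor k A n π b * pureTensor k A n τ c =
      pureTensor k A n σ a * (pureTensor k A n π b * pureTensor k A n τ c)
    simp only [pureTensor_mul_pureTensor, mul_inv_rev, Equiv.Perm.mul_apply, mul_assoc]
  exact congrArg (fun f => f x y z) h

noncomputable instance : Ring (WreathAlgebra k A n) :=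
  { (inferInstance : AddCommGroup (WreathAlgebra k A n)),
    (inferInstance : Mul (WreathAlgebra k A n)), (inferInstance : One (WreathAlgebra k A n)) with
    left_distrib := fun x y z => map_add (mulMap k A n x) y z
    right_distrib := fun x y z => LinearMap.map_add₂ (mulMap k A n) x y z
    zero_mul := fun x => LinearMap.map_zero₂ (mulMap k A n) x
    mul_zero := fun x => map_zero (mulMap k A n x)
    mul_assoc := mul_assoc_aux
    one_mul := fun x => by
      have h : mulMap k A n (pureTensor k A n 1 fun _ => 1) = LinearMap.id := by
        apply hom_ext
        intro σ a
        change pureTensor k A n 1 (fun _ => 1) * pureTensor k A n σ a = pureTensor k A n σ a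
        simp [pureTensor_mul_pureTensor]
      exact congrArg (fun f => f x) h
    mul_one := fun x => by
      have h : (mulMap k A n).flip (pureTensor k A n 1 fun _ => 1) = LinearMap.id := by
        apply hom_ext
        intro σ a
        change pureTensor k A n σ a * pureTensor k A n 1 (fun _ => 1) = pureTensor k A n σ a
        simp [pureTensor_mul_pureTensor]
      exact congrArg (fun f => f x) h }

noncomputable instance : Algebra k (WreathAlgebra k A n) :=
  Algebra.ofModule (fun r x y => LinearMap.map_smul₂ (mulMap k A n) r x y)
    (fun r x y => map_smul (mulMap k A n x) r y)

end WreathAlgebra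

/-! ### Semiprimeness as a test for semisimplicity -/

section Semiprime

/-! Two properties drive the proof: semisimple rings are semiprime (`xRx = 0` forces `x = 0`), and
an algebra with a separability idempotent is semisimple. Cellularity supplies `c ≠ 0` with `cAc ⊆
kc`, also in every nonzero quotient. If the wreath product is semisimple, put `s = ∑ σ, (σ; c, …,
c)`. Each `s w s` is a multiple of `n! s`, so `n! ≠ 0` in `k`, and Maschke applies. If `xAx = 0`,
then `(1; x, …, x)` violates semiprimeness unless `x = 0`; so `A` is semiprime and Artinian, hence
semisimple. Conversely, semisimplicity of `kS_n` forces `n! ≠ 0`, and `c` in each simple quotient of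
`A` forces its division ring to be `k`. Thus `A` is a product of matrix algebras over `k` and has a
separability idempotent; averaging its `n`-fold tensor power over `S_n` gives one for the wreath
product. -/

theorem IsSemisimpleRing.eq_zero_of_mul_mul_self_eq_zero {R : Type*} [Ring R] [IsSemisimpleRing R]
    {x : R} (h : ∀ a, x * a * x = 0) : x = 0 := by
  obtain ⟨q, hq⟩ := exists_isCompl (Ideal.span {x})
  have h1 : (1 : R) ∈ Ideal.span {x} ⊔ q := by rw [hq.sup_eq_top]; trivial
  obtain ⟨u, hu, v, hv, huv⟩ := Submodule.mem_sup.1 h1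
  obtain ⟨w, rfl⟩ := Ideal.mem_span_singleton'.1 hu
  -- With `1 = w x + v` and `x w x = 0`, `x = x v` lies in both `Rx` and its complement.
  have hx : x * v = x := by
    calc x * v = x * (w * x + v) := by rw [mul_add, ← mul_assoc, h, zero_add]
      _ = x := by rw [huv, mul_one]
  exact Submodule.disjoint_def.1 hq.disjoint x (Ideal.mem_span_singleton_self x)
    (hx ▸ q.smul_mem x hv)

/-- The last nonzero power of the nilpotent radical, if proper, would consist of `x` with `xRx = 0`.
-/
theorem IsArtinianRing.isSemisimpleRing_of_mul_mul_self {R : Type*} [Ring R] [IsArtinianRing R]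
    (h : ∀ x : R, (∀ a, x * a * x = 0) → x = 0) : IsSemisimpleRing R := by
  rw [IsArtinianRing.isSemisimpleRing_iff_jacobson]
  by_contra hJ
  have hnil : ∃ m, Ring.jacobson R ^ m = ⊥ := IsSemiprimaryRing.isNilpotent
  classical
  obtain ⟨m, hm⟩ : ∃ m, Nat.find hnil = m := ⟨_, rfl⟩
  have hspec := Nat.find_spec hnil
  have hmin := fun j => @Nat.find_min _ _ hnil j
  rw [hm] at hspec hmin
  match m with
  | 0 =>
    rw [Submodule.pow_zero, Ideal.one_eq_top] at hspec
    exact hJ (le_bot_iff.1 (hspec ▸ le_top))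
  | 1 => exact hJ (by simpa [Submodule.pow_one] using hspec)
  | m + 2 =>
    obtain ⟨x, hx, hx0⟩ := Submodule.exists_mem_ne_zero_of_ne_bot (hmin (m + 1) (by omega))
    refine hx0 (h x fun a => ?_)
    have hmem : x * (a * x) ∈ Ring.jacobson R ^ (m + 1 + (m + 1)) := by
      rw [Submodule.pow_add _ (by omega)]
      exact Ideal.mul_mem_mul hx (Ideal.mul_mem_left _ a hx)
    have hle : Ring.jacobson R ^ (m + 1 + (m + 1)) ≤ Ring.jacobson R ^ (m + 2) :=
      Ideal.pow_le_pow_right (by omega)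
    rw [mul_assoc]
    simpa [hspec] using hle hmem

/-- The sum `s` of all group elements is nonzero and absorbs each of them, so `s² = |G| s`; if `|G|
= 0` in `k`, semiprimeness fails at `s`. -/
theorem MonoidAlgebra.natCard_ne_zero_of_isSemisimpleRing {k G : Type*} [Field k] [Group G]
    [Finite G] [IsSemisimpleRing (MonoidAlgebra k G)] : (Nat.card G : k) ≠ 0 := by
  intro h0
  have := Fintype.ofFinite G
  let s : MonoidAlgebra k G := ∑ g : G, MonoidAlgebra.single g 1
  have hl (g : G) (r : k) : s * MonoidAlgebra.single g r = r • s := by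
    simp only [s, Finset.sum_mul, MonoidAlgebra.single_mul_single, one_mul, Finset.smul_sum]
    exact Fintype.sum_bijective (· * g) (Group.mulRight_bijective g) _ _ fun i ↦ by simp
  have hss : s * s = 0 := by
    conv_lhs => enter [2]; simp only [s]
    rw [Finset.mul_sum]
    simp only [hl, one_smul, Finset.sum_const, Finset.card_univ]
    rw [← Nat.cast_smul_eq_nsmul k, Fintype.card_eq_nat_card, h0, zero_smul]
  have hs : s = 0 := by
    refine IsSemisimpleRing.eq_zero_of_mul_mul_self_eq_zero fun a => ?_
    induction a using MonoidAlgebra.induction_linear with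
    | zero => simp
    | add f g hf hg => rw [mul_add, add_mul, hf, hg, add_zero]
    | single g r => rw [hl, smul_mul_assoc, hss, smul_zero]
  have hc : s.coeff 1 = 1 := by
    classical
    simp [s, MonoidAlgebra.coeff_sum, Finsupp.finsetSum_apply, Finsupp.single_apply]
  simp [hs] at hc

end Semiprime

/-! ### Separability idempotents -/

section SeparabilitySystem

/-- Finite families `x`, `y` in a `k`-algebra such that `∑ i, x i ⊗ y i` is a separability
idempotent; the commutation rule is expressed by matrices over `k`. -/
structure IsSeparabilitySystem (k : Type*) {R I : Type*} [Field k] [Ring R] [Algebra k R]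
    [Fintype I] (x y : I → R) : Prop where
  sum_mul : ∑ i, x i * y i = 1
  exists_matrix : ∀ a : R, ∃ c : I → I → k,
    (∀ i, a * x i = ∑ j, c j i • x j) ∧ ∀ j, y j * a = ∑ i, c j i • y i

variable {k R I : Type*} [Field k] [Ring R] [Algebra k R] [Fintype I] {x y : I → R}

/-- Averaging a `k`-linear projection `p` onto a left ideal `N` as `∑ xᵢ p(yᵢ m)` makes it
`R`-linear, as in Maschke's theorem. -/
theorem IsSeparabilitySystem.isSemisimpleRing (h : IsSeparabilitySystem k x y) :
    IsSemisimpleRing R := by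
  refine { exists_isCompl := fun N => ?_ }
  obtain ⟨p, hp⟩ := (N.restrictScalars k).subtype.exists_leftInverse_of_injective
    (Submodule.ker_subtype _)
  let P : R → R := fun m => ∑ i, x i * (p (y i * m) : R)
  have hPN (m : R) : P m ∈ N := Submodule.sum_mem _ fun i _ => N.smul_mem (x i) (p (y i * m)).2
  have hPid (m : R) (hm : m ∈ N) : P m = m := by
    have (i : I) : (p (y i * m) : R) = y i * m :=
      congrArg Subtype.val (LinearMap.congr_fun hp ⟨y i * m, N.smul_mem (y i) hm⟩)
    simp only [P, this, ← mul_assoc, ← Finset.sum_mul, h.sum_mul, one_mul]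
  have hPmul (a m : R) : P (a * m) = a * P m := by
    obtain ⟨c, hx, hy⟩ := h.exists_matrix a
    simp only [P, ← mul_assoc, hy, Finset.mul_sum, hx, Finset.sum_mul, map_sum, smul_mul_assoc,
      map_smul, Submodule.coe_sum, Submodule.coe_smul, mul_smul_comm]
    exact Finset.sum_comm
  refine ⟨_, LinearMap.isCompl_of_proj
    (f := (LinearMap.toSpanSingleton R R (P 1)).codRestrict N fun m => N.smul_mem m (hPN 1))
    fun m => Subtype.ext ?_⟩
  change (m : R) * P 1 = m
  rw [← hPmul, mul_one, hPid _ m.2]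

theorem IsSeparabilitySystem.map {S : Type*} [Ring S] [Algebra k S]
    (h : IsSeparabilitySystem k x y) (e : R ≃ₐ[k] S) :
    IsSeparabilitySystem k (fun i => e (x i)) (fun i => e (y i)) where
  sum_mul := by simp only [← map_mul, ← map_sum, h.sum_mul, map_one]
  exists_matrix a := by
    obtain ⟨c, hx, hy⟩ := h.exists_matrix (e.symm a)
    refine ⟨c, fun i => ?_, fun j => ?_⟩
    · simpa using congrArg e (hx i)
    · simpa using congrArg e (hy j)

theorem isSeparabilitySystem_pi_matrix {ι : Type*} [Fintype ι] [DecidableEq ι] (d : ι → ℕ)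
    [∀ i, NeZero (d i)] :
    IsSeparabilitySystem k
      (fun p : Σ i, Fin (d i) =>
        (Pi.single p.1 (Matrix.single p.2 0 1) : ∀ i, Matrix (Fin (d i)) (Fin (d i)) k))
      (fun p => Pi.single p.1 (Matrix.single 0 p.2 1)) where
  sum_mul := by
    have hone (i : ι) : ∑ r : Fin (d i), Matrix.single r r (1 : k) = 1 := by
      ext r s
      simp [Matrix.sum_apply, Matrix.single_apply, Matrix.one_apply, ite_and]
    have hsum (i : ι) : ∑ r : Fin (d i),
        (Pi.single i (Matrix.single r r 1) : ∀ i, Matrix (Fin (d i)) (Fin (d i)) k) =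
          Pi.single i 1 := by
      rw [← hone i]
      exact (map_sum (AddMonoidHom.single (fun i => Matrix (Fin (d i)) (Fin (d i)) k) i) _ _).symm
    simp only [← Pi.single_mul, Matrix.single_mul_single_same, mul_one, Fintype.sum_sigma, hsum]
    exact Finset.univ_sum_single _
  exists_matrix a := by
    -- Block-diagonal matrix of `a`: left multiplication acts on each first column by the block's
    -- own entries. `Pi.single` compares blocks without casts.
    refine ⟨fun p q => (Pi.single q.1 fun s => a q.1 s q.2 : ∀ i, Fin (d i) → k) p.1 p.2, ?_, ?_⟩
    · rintro ⟨i, r⟩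
      ext j s t
      rw [Fintype.sum_sigma, Fintype.sum_eq_single i]
      · obtain rfl | hj := eq_or_ne j i
        · simp [Matrix.sum_apply, Matrix.mul_apply, Matrix.single_apply, ite_and]
        · simp [hj]
      · intro j hj
        simp [Pi.single_eq_of_ne hj]
    · rintro ⟨i, r⟩
      ext j s t
      rw [Fintype.sum_sigma, Fintype.sum_eq_single i]
      · obtain rfl | hj := eq_or_ne j i
        · simp [Matrix.sum_apply, Matrix.mul_apply, Matrix.single_apply, ite_and]
          split_ifs <;> simp
        · simp [hj]
      · intro j hj
        simp [Pi.single_eq_of_ne hj.symm]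

end SeparabilitySystem

/-- If a matrix algebra over a division algebra `D` contains a nonzero `c` with all `c b c`
proportional to `c`, then `D` is the base field. -/
theorem Matrix.algebraMap_surjective_of_mul_mul_self {k D ι : Type*} [Field k]
    [DivisionRing D]
    [Algebra k D] [Fintype ι] [DecidableEq ι] {c : Matrix ι ι D} (hc : c ≠ 0)
    (h : ∀ b, ∃ t : k, c * b * c = t • c) : Function.Surjective (algebraMap k D) := by
  obtain ⟨r, s, hrs⟩ : ∃ r s, c r s ≠ 0 := by
    by_contra! h0
    exact hc (Matrix.ext h0)
  have key (x : D) : ∃ t : k, c r s * x = algebraMap k D t := by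
    obtain ⟨t, ht⟩ := h (Matrix.single s r x)
    -- The `(r, s)` entry of `c b c = t c` reads `c_rs x c_rs = t c_rs`.
    refine ⟨t, mul_right_cancel₀ hrs ?_⟩
    have := congrFun (congrFun ht r) s
    simpa [Matrix.mul_apply, Matrix.single_apply, ite_and, Algebra.smul_def] using this
  intro x
  obtain ⟨t, ht⟩ := key ((c r s)⁻¹ * x)
  exact ⟨t, by rw [← ht, mul_inv_cancel_left₀ hrs]⟩

/-! ### Splitness of semisimple cellular algebras -/

namespace CellularData

variable {k A : Type*} [Field k] [Ring A] [Algebra k A] {Lam : Type*} [PartialOrder Lam]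
  {M : Lam → Type*} [∀ l, Fintype (M l)]

theorem span_lower_eq (C : CellularData k A Lam M) (l : Lam) :
    Submodule.span k {x : A | ∃ m : Lam, m < l ∧ ∃ U V : M m, x = C.basis ⟨m, (U, V)⟩} =
      Submodule.span k (C.basis '' {i | i.1 < l}) := by
  congr 1
  ext x
  constructor
  · rintro ⟨m, hm, U, V, rfl⟩
    exact ⟨_, hm, rfl⟩
  · rintro ⟨⟨m, U, V⟩, hm, rfl⟩
    exact ⟨m, hm, U, V, rfl⟩

theorem basis_mul_mem (C : CellularData k A Lam M) (l : Lam) (S T : M l) (a : A) :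
    C.basis ⟨l, (S, T)⟩ * a ∈
      Submodule.span k (C.basis '' {i | i.1 < l ∨ ∃ X, i = ⟨l, (S, X)⟩}) := by
  obtain ⟨R, hR⟩ := C.basis_mul a l
  have h := hR S T
  rw [span_lower_eq] at h
  rw [← sub_add_cancel (C.basis ⟨l, (S, T)⟩ * a) (∑ X : M l, R T X • C.basis ⟨l, (S, X)⟩)]
  exact add_mem (Submodule.span_mono (Set.image_mono fun _ => Or.inl) h)
    (sum_mem fun X _ => Submodule.smul_mem _ _
      (Submodule.subset_span ⟨_, Or.inr ⟨X, rfl⟩, rfl⟩))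

theorem mul_basis_mem (C : CellularData k A Lam M) (l : Lam) (S T : M l) (a : A) :
    a * C.basis ⟨l, (S, T)⟩ ∈
      Submodule.span k (C.basis '' {i | i.1 < l ∨ ∃ X, i = ⟨l, (X, T)⟩}) := by
  have h := Submodule.mem_map_of_mem (f := C.invol) (C.basis_mul_mem l T S (C.invol a))
  rw [C.invol_mul, C.invol_invol, C.invol_basis, Submodule.map_span, ← Set.image_comp] at h
  refine Submodule.span_mono ?_ h
  rintro _ ⟨⟨m, U, V⟩, hi, rfl⟩
  refine ⟨⟨m, (V, U)⟩, hi.imp id ?_, (C.invol_basis m U V).symm⟩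
  rintro ⟨X, hX⟩
  cases hX
  exact ⟨X, rfl⟩

/-- Modulo lower cells the product lies in row `S` and in column `T`, which meet in one basis
element. -/
theorem basis_mul_mul_basis_mem (C : CellularData k A Lam M) (l : Lam) (S T : M l) (a : A) :
    C.basis ⟨l, (S, T)⟩ * a * C.basis ⟨l, (S, T)⟩ ∈
      Submodule.span k (C.basis '' {i | i.1 < l ∨ i = ⟨l, (S, T)⟩}) := by
  have h1 := C.basis_mul_mem l S T (a * C.basis ⟨l, (S, T)⟩)
  have h2 := C.mul_basis_mem l S T (C.basis ⟨l, (S, T)⟩ * a)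
  rw [← mul_assoc] at h1
  rw [Module.Basis.mem_span_image] at h1 h2 ⊢
  intro i hi
  obtain h | ⟨X, rfl⟩ := h1 hi
  · exact Or.inl h
  · obtain h | ⟨Y, hY⟩ := h2 hi
    · exact Or.inl h
    · cases hY
      exact Or.inr rfl

/-- Every nonzero quotient of a finite-dimensional cellular algebra contains a nonzero element `c`
such that `c b c` is a scalar multiple of `c` for all `b`. -/
theorem exists_mul_mul_self_eq_smul (C : CellularData k A Lam M) [FiniteDimensional k A] {B : Type*} [Ring B] [Nontrivial B]
    [Algebra k B] (f : A →ₐ[k] B) (hf : Function.Surjective f) :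
    ∃ c : B, c ≠ 0 ∧ ∀ b, ∃ t : k, c * b * c = t • c := by
  have : Finite (Σ l : Lam, M l × M l) := Module.Finite.finite_basis C.basis
  have hne : (Sigma.fst '' {i | f (C.basis i) ≠ 0}).Nonempty := by
    by_contra h
    have hzero : f.toLinearMap = 0 := C.basis.ext fun i => by
      by_contra hi
      exact h ⟨_, i, hi, rfl⟩
    exact one_ne_zero ((map_one f).symm.trans (LinearMap.congr_fun hzero 1))
  -- In a minimal cell not killed by `f`, all lower terms vanish in `B`.
  obtain ⟨l, hl⟩ := ((Set.toFinite {i | f (C.basis i) ≠ 0}).image Sigma.fst).exists_minimal hne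
  obtain ⟨⟨l, S, T⟩, hST, rfl⟩ := hl.1
  refine ⟨_, hST, fun b => ?_⟩
  obtain ⟨a, rfl⟩ := hf b
  have h := Submodule.mem_map_of_mem (f := f.toLinearMap) (C.basis_mul_mul_basis_mem _ S T a)
  rw [Submodule.map_span, ← Set.image_comp] at h
  have hle : Submodule.span k ((f.toLinearMap ∘ C.basis) '' {i | i.1 < l ∨ i = ⟨l, (S, T)⟩}) ≤
      Submodule.span k {f (C.basis ⟨l, (S, T)⟩)} := by
    rw [Submodule.span_le]
    rintro _ ⟨i, hi | rfl, rfl⟩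
    · have : f (C.basis i) = 0 := by
        by_contra h0
        exact hl.not_lt ⟨i, h0, rfl⟩ hi
      simp [this]
    · exact Submodule.mem_span_singleton_self _
  obtain ⟨t, ht⟩ := Submodule.mem_span_singleton.1 (hle h)
  exact ⟨t, by simpa using ht.symm⟩

/-- A semisimple cellular algebra is split. -/
theorem exists_algEquiv_pi_matrix (C : CellularData k A Lam M) [FiniteDimensional k A] [IsSemisimpleRing A] :
    ∃ (m : ℕ) (d : Fin m → ℕ), (∀ i, NeZero (d i)) ∧
      Nonempty (A ≃ₐ[k] ∀ i, Matrix (Fin (d i)) (Fin (d i)) k) := by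
  obtain ⟨m, D, d, _, _, hd, ⟨e⟩⟩ := IsSemisimpleRing.exists_algEquiv_pi_matrix_divisionRing k A
  refine ⟨m, d, hd, ⟨e.trans (AlgEquiv.piCongrRight fun i => ?_)⟩⟩
  obtain hs : Function.Surjective (algebraMap k (D i)) := by
    obtain ⟨c, hc, h⟩ := C.exists_mul_mul_self_eq_smul
      ((Pi.evalAlgHom k (fun i => Matrix (Fin (d i)) (Fin (d i)) (D i)) i).comp e.toAlgHom)
      ((Function.surjective_eval i).comp e.surjective)
    exact Matrix.algebraMap_surjective_of_mul_mul_self hc h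
  exact (AlgEquiv.ofBijective (Algebra.ofId k (D i))
    ⟨(algebraMap k (D i)).injective, hs⟩).symm.mapMatrix

theorem exists_isSeparabilitySystem (C : CellularData k A Lam M) [FiniteDimensional k A] [IsSemisimpleRing A] :
    ∃ (m : ℕ) (d : Fin m → ℕ) (x y : (Σ i, Fin (d i)) → A), IsSeparabilitySystem k x y := by
  obtain ⟨m, d, hd, ⟨e⟩⟩ := C.exists_algEquiv_pi_matrix
  exact ⟨m, d, _, _, (isSeparabilitySystem_pi_matrix d).map e.symm⟩

end CellularData

/-! ### Semisimplicity of the wreath product -/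

namespace WreathAlgebra

variable {k A : Type*} [Field k] [Ring A] [Algebra k A] {n : ℕ}

/-- The pure tensor `(σ; a_1, …, a_n)` as a multilinear function of `a`. -/
noncomputable def pureTensorMultilinear (σ : Equiv.Perm (Fin n)) :
    MultilinearMap k (fun _ : Fin n => A) (WreathAlgebra k A n) :=
  (tmul k A n (MonoidAlgebra.single σ 1)).compMultilinearMap (PiTensorProduct.tprod k)

theorem pureTensor_smul (σ : Equiv.Perm (Fin n)) (t : Fin n → k) (a : Fin n → A) :
    pureTensor k A n σ (fun i => t i • a i) = (∏ i, t i) • pureTensor k A n σ a :=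
  (pureTensorMultilinear σ).map_smul_univ t a

theorem pureTensor_sum {I : Type*} [Fintype I] (σ : Equiv.Perm (Fin n))
    (a : Fin n → I → A) :
    pureTensor k A n σ (fun i => ∑ j, a i j) =
      ∑ f : Fin n → I, pureTensor k A n σ fun i => a i (f i) := by
  classical exact (pureTensorMultilinear σ).map_sum a

theorem span_range_pureTensor :
    Submodule.span k (Set.range fun p : Equiv.Perm (Fin n) × (Fin n → A) =>
      pureTensor k A n p.1 p.2) = ⊤ := by
  rw [← Submodule.ker_mkQ (Submodule.span k _), LinearMap.ker_eq_top]
  refine hom_ext fun σ a => ?_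
  exact (Submodule.Quotient.mk_eq_zero _).2 (Submodule.subset_span ⟨(σ, a), rfl⟩)

theorem induction_on {p : WreathAlgebra k A n → Prop} (x : WreathAlgebra k A n)
    (pure : ∀ σ a, p (pureTensor k A n σ a)) (zero : p 0) (add : ∀ x y, p x → p y → p (x + y))
    (smul : ∀ (t : k) x, p x → p (t • x)) : p x := by
  have hx : x ∈ Submodule.span k (Set.range fun p : Equiv.Perm (Fin n) × (Fin n → A) =>
      pureTensor k A n p.1 p.2) := by rw [span_range_pureTensor]; trivial
  induction hx using Submodule.span_induction with
  | mem x hx => obtain ⟨q, rfl⟩ := hx; exact pure _ _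
  | zero => exact zero
  | add x y _ _ hx hy => exact add x y hx hy
  | smul t x _ hx => exact smul t x hx

/-- The functional `(σ; a_1, …, a_n) ↦ g a_1 ⋯ g a_n` for `σ = 1`, and `0` for `σ ≠ 1`. -/
noncomputable def coeffOne (g : A →ₗ[k] k) : WreathAlgebra k A n →ₗ[k] k :=
  TensorProduct.lift (ofPerm k n fun σ => if σ = 1 then
    PiTensorProduct.lift ((MultilinearMap.mkPiAlgebra k (Fin n) k).compLinearMap fun _ => g)
    else 0)

theorem coeffOne_pureTensor (g : A →ₗ[k] k) (σ : Equiv.Perm (Fin n)) (a : Fin n → A) :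
    coeffOne g (pureTensor k A n σ a) = if σ = 1 then ∏ i, g (a i) else 0 := by
  unfold coeffOne pureTensor tmul
  erw [TensorProduct.lift.tmul, ofPerm_single]
  split_ifs
  · simp
  · simp

theorem pureTensor_one_ne_zero {x : A} (hx : x ≠ 0) :
    pureTensor k A n 1 (fun _ => x) ≠ 0 := by
  obtain ⟨g, hg⟩ : ∃ g : A →ₗ[k] k, g x ≠ 0 := by
    by_contra! h
    exact hx ((Module.forall_dual_apply_eq_zero_iff k x).1 h)
  intro h
  have h1 := coeffOne_pureTensor g (1 : Equiv.Perm (Fin n)) fun _ => x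
  rw [h, map_zero, if_pos rfl] at h1
  exact Finset.prod_ne_zero_iff.2 (fun _ _ => hg) h1.symm

theorem sum_pureTensor_ne_zero {x : A} (hx : x ≠ 0) :
    ∑ σ, pureTensor k A n σ (fun _ => x) ≠ 0 := by
  obtain ⟨g, hg⟩ : ∃ g : A →ₗ[k] k, g x ≠ 0 := by
    by_contra! h
    exact hx ((Module.forall_dual_apply_eq_zero_iff k x).1 h)
  intro h
  have h1 := congrArg (coeffOne g) h
  simp only [map_sum, coeffOne_pureTensor, map_zero, Finset.sum_ite_eq', Finset.mem_univ,
    if_true] at h1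
  exact Finset.prod_ne_zero_iff.2 (fun _ _ => hg) h1

theorem isSemisimpleRing_of_wreath [FiniteDimensional k A] (hn : 1 ≤ n)
    [IsSemisimpleRing (WreathAlgebra k A n)] : IsSemisimpleRing A := by
  have : IsArtinianRing A := IsArtinianRing.of_finite k A
  refine IsArtinianRing.isSemisimpleRing_of_mul_mul_self fun x hx => ?_
  by_contra hx0
  refine pureTensor_one_ne_zero (k := k) (n := n) hx0
    (IsSemisimpleRing.eq_zero_of_mul_mul_self_eq_zero fun w => ?_)
  induction w using induction_on with
  | pure σ a =>
    simp only [pureTensor_mul_pureTensor, hx]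
    -- A zero entry kills the tensor; `n ≥ 1` provides one.
    exact (pureTensorMultilinear (k := k) _).map_coord_zero ⟨0, hn⟩ rfl
  | zero => simp
  | add x y hx hy => rw [mul_add, add_mul, hx, hy, add_zero]
  | smul t x hx => rw [mul_smul_comm, smul_mul_assoc, hx, smul_zero]

/-- Constant tensors ignore permutation of entries, so each `τ` in the right factor merely reindexes
the left sum, giving `n!` equal terms. -/
theorem sum_mul_pureTensor_mul_sum {c : A} (t : A → k) (hc : ∀ a, c * a * c = t a • c)
    (π : Equiv.Perm (Fin n)) (a : Fin n → A) :
    (∑ σ, pureTensor k A n σ fun _ => c) * pureTensor k A n π a *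
        (∑ σ, pureTensor k A n σ fun _ => c) =
      (Nat.card (Equiv.Perm (Fin n)) : k) •
        ((∏ i, t (a i)) • ∑ σ, pureTensor k A n σ fun _ => c) := by
  have hτ (τ : Equiv.Perm (Fin n)) :
      (∑ σ, pureTensor k A n σ fun _ => c) * pureTensor k A n π a *
        pureTensor k A n τ (fun _ => c) = (∏ i, t (a i)) • ∑ σ, pureTensor k A n σ fun _ => c := by
    simp only [Finset.sum_mul, pureTensor_mul_pureTensor, hc, pureTensor_smul, Finset.smul_sum,
      Equiv.prod_comp τ⁻¹ fun i => t (a i)]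
    refine Fintype.sum_bijective (fun σ => τ * (π * σ))
      ((Group.mulLeft_bijective τ).comp (Group.mulLeft_bijective π)) _ _ fun σ => rfl
  simp only [Finset.mul_sum _ _ (_ * _), hτ, Finset.sum_const, Finset.card_univ]
  rw [← Nat.cast_smul_eq_nsmul k, Fintype.card_eq_nat_card]

theorem natCard_perm_ne_zero {c : A} (hc0 : c ≠ 0) (hc : ∀ a, ∃ t : k, c * a * c = t • c)
    [IsSemisimpleRing (WreathAlgebra k A n)] : (Nat.card (Equiv.Perm (Fin n)) : k) ≠ 0 := by
  intro h0
  choose t ht using hc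
  refine sum_pureTensor_ne_zero (k := k) (n := n) hc0
    (IsSemisimpleRing.eq_zero_of_mul_mul_self_eq_zero fun w => ?_)
  induction w using induction_on with
  | pure σ a => rw [sum_mul_pureTensor_mul_sum t ht, h0, zero_smul]
  | zero => simp
  | add x y hx hy => rw [mul_add, add_mul, hx, hy, add_zero]
  | smul t x hx => rw [mul_smul_comm, smul_mul_assoc, hx, smul_zero]

/-- The entries of the second family are permuted so that `x` and `y` meet with equal indices in the
product; every `σ` then contributes `1`. -/
theorem isSeparabilitySystem {I : Type*} [Fintype I] {x y : I → A}
    (h : IsSeparabilitySystem k x y) (hcard : (Nat.card (Equiv.Perm (Fin n)) : k) ≠ 0) :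
    IsSeparabilitySystem k
      (fun p : Equiv.Perm (Fin n) × (Fin n → I) =>
        (Nat.card (Equiv.Perm (Fin n)) : k)⁻¹ • pureTensor k A n p.1 fun t => x (p.2 t))
      (fun p => pureTensor k A n p.1⁻¹ fun t => y (p.2 (p.1 t))) where
  sum_mul := by
    have hσ (σ : Equiv.Perm (Fin n)) : ∑ f : Fin n → I, pureTensor k A n (σ⁻¹ * σ)
        (fun t => x (f (σ t)) * y (f (σ t))) = 1 := by
      rw [Fintype.sum_equiv (σ.symm.arrowCongr (Equiv.refl I)) _
        (fun f => pureTensor k A n (σ⁻¹ * σ) fun t => x (f t) * y (f t)) fun f => by simp,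
        ← pureTensor_sum (σ⁻¹ * σ) fun _ i => x i * y i, inv_mul_cancel, h.sum_mul]
      rfl
    simp only [Fintype.sum_prod_type, smul_mul_assoc, pureTensor_mul_pureTensor, inv_inv,
      ← Finset.smul_sum, hσ, Finset.sum_const, Finset.card_univ]
    rw [← Nat.cast_smul_eq_nsmul k, Fintype.card_eq_nat_card, smul_smul, inv_mul_cancel₀ hcard,
      one_smul]
  exists_matrix w := by
    induction w using induction_on with
    | pure π a =>
      choose c hx hy using h.exists_matrix
      classical
      -- Read off from `(π; a)(σ; x_f)`, whose permutation is `σ * π` and whose entry `t` is `a (σ⁻¹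
      -- t) * x (f t)`.
      refine ⟨fun p q => if p.1 = q.1 * π then ∏ t, c (a (q.1⁻¹ t)) (p.2 t) (q.2 t) else 0,
        ?_, ?_⟩
      · rintro ⟨σ, f⟩
        simp only [Fintype.sum_prod_type, ite_smul, zero_smul, mul_smul_comm,
          pureTensor_mul_pureTensor, hx, pureTensor_sum, pureTensor_smul]
        rw [Fintype.sum_eq_single (σ * π) fun τ hτ => by simp [hτ]]
        simp only [if_true, Finset.smul_sum, smul_comm (Nat.card (Equiv.Perm (Fin n)) : k)⁻¹]
      · rintro ⟨σ, f⟩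
        have hiff (ρ : Equiv.Perm (Fin n)) : σ = ρ * π ↔ ρ = σ * π⁻¹ := by
          rw [eq_mul_inv_iff_mul_eq, eq_comm]
        simp only [Fintype.sum_prod_type, ite_smul, zero_smul, hiff,
          pureTensor_mul_pureTensor]
        rw [Fintype.sum_eq_single (σ * π⁻¹) fun τ hτ => by simp [hτ]]
        simp only [if_true, mul_inv_rev, inv_inv, Equiv.Perm.mul_apply, hy, pureTensor_sum,
          pureTensor_smul]
        refine (Fintype.sum_equiv ((σ * π⁻¹).arrowCongr (Equiv.refl I)).symm _ _ fun g => ?_).symm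
        rw [← Equiv.prod_comp (σ * π⁻¹)]
        simp
    | zero => exact ⟨0, by simp, by simp⟩
    | add v w hv hw =>
      obtain ⟨c, hx, hy⟩ := hv
      obtain ⟨d, hx', hy'⟩ := hw
      exact ⟨c + d, fun i => by simp only [add_mul, hx, hx', Pi.add_apply, add_smul,
        Finset.sum_add_distrib], fun j => by simp only [mul_add, hy, hy', Pi.add_apply, add_smul,
        Finset.sum_add_distrib]⟩
    | smul t w hw =>
      obtain ⟨c, hx, hy⟩ := hw
      exact ⟨t • c, fun i => by simp only [smul_mul_assoc, hx, Pi.smul_apply, smul_eq_mul,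
        mul_smul, Finset.smul_sum], fun j => by simp only [mul_smul_comm, hy, Pi.smul_apply,
        smul_eq_mul, mul_smul, Finset.smul_sum]⟩

end WreathAlgebra

theorem mainTheorem4 {k A : Type*} [Field k] [Ring A] [Algebra k A] [FiniteDimensional k A]
    [Nontrivial A] {Lam : Type*} [PartialOrder Lam] {M : Lam → Type*} [∀ l, Fintype (M l)]
    (C : CellularData k A Lam M) (n : ℕ) (hn : 1 ≤ n) :
    IsSemisimpleRing (WreathAlgebra k A n) ↔
      (IsSemisimpleRing (MonoidAlgebra k (Equiv.Perm (Fin n))) ∧ IsSemisimpleRing A) := by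
  constructor
  · intro _
    obtain ⟨c, hc0, hc⟩ := C.exists_mul_mul_self_eq_smul (AlgHom.id k A) Function.surjective_id
    have : NeZero (Nat.card (Equiv.Perm (Fin n)) : k) :=
      ⟨WreathAlgebra.natCard_perm_ne_zero hc0 hc⟩
    exact ⟨inferInstance, WreathAlgebra.isSemisimpleRing_of_wreath (k := k) hn⟩
  · rintro ⟨_, _⟩
    obtain ⟨m, d, x, y, h⟩ := C.exists_isSeparabilitySystem
    exact (WreathAlgebra.isSeparabilitySystem h
      MonoidAlgebra.natCard_ne_zero_of_isSemisimpleRing).isSemisimpleRing
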